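/- Let $\rho\in(\tfrac12,1)$ and $\beta>2$. Let $a_\rho:\mathbb R^2\to\{1,\beta\}$ be the $\mathbb Z^2$-periodic function which on $[0,1]^2$ equals $\beta$ on the open square $\left(\tfrac{1-\rho}{2},\tfrac{1+\rho}{2}\right)^2$ and $1$ elsewhere, and let $A_\rho(x,y):=a_\rho\left(x+\tfrac{1-\rho}{2},\,y-\tfrac{1-\rho}{2}\right)$. A geodesic joining $p$ to $q$ in $\mathbb R^2$ is a curve $\gamma\in W^{1,1}((0,1);\mathbb R^2)$ (equivalently, an absolutely continuous curve on $[0,1]$) with $\gamma(0)=p$, $\gamma(1)=q$ which minimises the length $$\int_0^1 A_\rho(\gamma(\tau))\,\|\gamma'(\tau)\|\,d\tau$$ among all such curves, where $\|\cdot\|$ is the Euclidean norm. Put $\ell_\rho(x):=\sqrt{(1-\rho)^2+(x-(1-\rho))^2}$. Then for all integers $M>N\ge 1$ a geodesic joining $(0,0)$ to $(M,N)$ exists, and every such geodesic has length $$N\,\ell_\rho(1)+\left(M-\left\lfloor \tfrac MN\right\rfloor N\right)\ell_\rho\left(\left\lfloor \tfrac MN\right\rfloor+1\right)+\left(N-M+\left\lfloor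 \tfrac MN\right\rfloor N\right)\ell_\rho\left(\left\lfloor \tfrac MN\right\rfloor\right).$$ -/

import Mathlib

noncomputable section

namespace TwoPhase

/-- The Euclidean plane. -/
abbrev Plane : Type := EuclideanSpace ℝ (Fin 2)

open scoped Classical in
/-- The two-phase metric coefficient `a_ρ`: on the unit cell it equals `β` on the open square
`((1 - ρ)/2, (1 + ρ)/2)²` and `1` elsewhere; it is extended `ℤ²`-periodically to the plane, by
reducing both coordinates modulo one. -/
def coeff (ρ β : ℝ) (p : Plane) : ℝ :=
  if Int.fract (p 0) ∈ Set.Ioo ((1 - ρ) / 2) ((1 + ρ) / 2) ∧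
      Int.fract (p 1) ∈ Set.Ioo ((1 - ρ) / 2) ((1 + ρ) / 2) then β else 1

/-- The shifted coefficient `A_ρ(x, y) = a_ρ(x + (1 - ρ)/2, y - (1 - ρ)/2)`. -/
def shiftedCoeff (ρ β : ℝ) (p : Plane) : ℝ :=
  coeff ρ β !₂[p 0 + (1 - ρ) / 2, p 1 - (1 - ρ) / 2]

/-- The shifted length functional `∫₀¹ A_ρ(γ(τ)) ‖γ'(τ)‖ dτ`. -/
def curveLength (ρ β : ℝ) (γ : ℝ → Plane) : ℝ :=
  ∫ τ in (0 : ℝ)..1, shiftedCoeff ρ β (γ τ) * ‖deriv γ τ‖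

/-- The admissible curves joining `p` to `q`: the curves of class `W^{1,1}(0,1)`, that is (taking
the continuous representative, for which the end point conditions make sense) the absolutely
continuous curves on `[0, 1]`, with `γ(0) = p` and `γ(1) = q`. The weak derivative is the almost
everywhere derivative. -/
def admissible (p q : Plane) : Set (ℝ → Plane) :=
  {γ | AbsolutelyContinuousOnInterval γ 0 1 ∧ γ 0 = p ∧ γ 1 = q}

/-- A geodesic joining `p` to `q`: an admissible curve that minimises the shifted length functional
among all admissible curves joining `p` to `q`. -/
def IsGeodesic (ρ β : ℝ) (p q : Plane) (γ : ℝ → Plane) : Prop :=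
  γ ∈ admissible p q ∧ ∀ η ∈ admissible p q, curveLength ρ β γ ≤ curveLength ρ β η

/-- The function `ℓ_ρ(x) = √((1 - ρ)² + (x - (1 - ρ))²)`. -/
def ell (ρ x : ℝ) : ℝ :=
  Real.sqrt ((1 - ρ) ^ 2 + (x - (1 - ρ)) ^ 2)

end TwoPhase

end

/-! After the shift the costly squares are `(n, n+ρ) × (j+1-ρ, j+1)`; horizontal strips of height
`1-ρ` and vertical strips of width `1-ρ` stay cheap. To climb one row while advancing `m` columns,
cross the horizontal strip obliquely (length `ell ρ m`), then follow the diagonal of a vertical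
strip (length `ell ρ 1`). Since `ell ρ` is convex, the `N` integer advances with sum `M` should be
as equal as possible: each is `k = ⌊M/N⌋` or `k+1`.

The lower bound is a calibration. `potential` has slope `steep` over the squares' columns and `tilt`
over the vertical strips, and gains `rise` per period. In a band containing squares, its slope
paired with vertical slope `ρ / ell ρ 1` is a field of norm at most the coefficient
(`band_crossing`). In a horizontal strip the slope `steep ≥ 1` forbids a pointwise calibration, so
only the end points of the crossing are compared (`potential_crossing`). That rests on the secant of
`ell ρ` through `k` and `k+1` lying below `ell ρ` at every integer.

Summing over rows (`length_lower_bound`) gives the length of the explicit path, because the secant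
touches at `k` and `k+1`. The path attains the bound, so existence needs no compactness argument. -/

noncomputable section

namespace TwoPhase

/-! ### Euclidean segment lengths and convexity of `ell` -/

/-- The length of a segment that rises by `d` while advancing by `t`. -/
def slant (d t : ℝ) : ℝ := Real.sqrt (d ^ 2 + t ^ 2)

lemma ell_eq_slant (ρ x : ℝ) : ell ρ x = slant (1 - ρ) (x - (1 - ρ)) := rfl

lemma slant_nonneg (d t : ℝ) : 0 ≤ slant d t := Real.sqrt_nonneg _

lemma slant_sq (d t : ℝ) : slant d t ^ 2 = d ^ 2 + t ^ 2 := Real.sq_sqrt (by positivity)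

lemma slant_pos {d : ℝ} (hd : 0 < d) (t : ℝ) : 0 < slant d t := Real.sqrt_pos.2 (by positivity)

lemma abs_le_slant (d t : ℝ) : |t| ≤ slant d t :=
  Real.abs_le_sqrt (by nlinarith [sq_nonneg d])

lemma linear_le_slant {a b : ℝ} (h : a ^ 2 + b ^ 2 ≤ 1) (d t : ℝ) : a * d + b * t ≤ slant d t := by
  apply Real.le_sqrt_of_sq_le
  nlinarith [sq_nonneg (a * t - b * d), mul_le_mul_of_nonneg_right h (by positivity : 0 ≤ d ^ 2 + t ^ 2)]

lemma inner_le_slant_mul (d s t : ℝ) : d ^ 2 + s * t ≤ slant d s * slant d t := by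
  rw [slant, slant, ← Real.sqrt_mul (by positivity)]
  apply Real.le_sqrt_of_sq_le
  nlinarith [sq_nonneg (d * (s - t))]

lemma slant_le_add_abs (d s t : ℝ) : slant d t ≤ slant d s + |t - s| := by
  have h1 := slant_sq d s
  have h2 := abs_le_slant d s
  refine Real.sqrt_le_iff.2 ⟨by positivity [slant_nonneg d s], ?_⟩
  have h3 : s * (t - s) ≤ slant d s * |t - s| := by
    calc s * (t - s) ≤ |s * (t - s)| := le_abs_self _
      _ = |s| * |t - s| := abs_mul _ _
      _ ≤ _ := by gcongr
  nlinarith [sq_abs (t - s)]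

/-- Pairing `(d, z)` with itself, `z` the convex combination, and expanding one factor reduces
convexity to Cauchy–Schwarz. -/
lemma convexOn_slant {d : ℝ} (hd : 0 < d) : ConvexOn ℝ Set.univ (slant d) := by
  refine ⟨convex_univ, fun s _ t _ a b ha hb hab => ?_⟩
  simp only [smul_eq_mul]
  set z := a * s + b * t with hz
  have hzp := slant_pos hd z
  have h1 := mul_le_mul_of_nonneg_left (inner_le_slant_mul d z s) ha
  have h2 := mul_le_mul_of_nonneg_left (inner_le_slant_mul d z t) hb
  have h3 := slant_sq d z
  have h4 : z ^ 2 = a * (z * s) + b * (z * t) := by rw [hz]; ring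
  have h5 : d ^ 2 = a * d ^ 2 + b * d ^ 2 := by rw [← add_mul, hab, one_mul]
  refine le_of_mul_le_mul_left ?_ hzp
  nlinarith

lemma convexOn_ell {ρ : ℝ} (hρ : ρ < 1) : ConvexOn ℝ Set.univ (ell ρ) := by
  have h := (convexOn_slant (sub_pos.2 hρ)).translate_left (-(1 - ρ))
  have he : ell ρ = slant (1 - ρ) ∘ fun z => z + -(1 - ρ) := by
    ext x
    simp only [ell_eq_slant, Function.comp_apply, sub_eq_add_neg]
  rw [he]
  exact h

/-- A convex function lies above the secant through consecutive integers, at every integer. -/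
lemma convexOn_secant_le_int {f : ℝ → ℝ} (hf : ConvexOn ℝ Set.univ f) (k m : ℤ) :
    f k + (f (k + 1) - f k) * (m - k) ≤ f m := by
  rcases lt_trichotomy m k with h | rfl | h
  · have h1 : (m : ℝ) < k := by exact_mod_cast h
    have := hf.slope_mono_adjacent (Set.mem_univ (m : ℝ)) (Set.mem_univ (k + 1 : ℝ)) h1 (by linarith)
    rw [div_le_div_iff₀ (by linarith) (by linarith)] at this
    linarith
  · simp
  · obtain rfl | h2 := (Int.add_one_le_iff.2 h).eq_or_lt
    · push_cast; linarith
    have h1 : (k : ℝ) + 1 < m := by exact_mod_cast h2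
    have := hf.slope_mono_adjacent (Set.mem_univ (k : ℝ)) (Set.mem_univ (m : ℝ)) (by linarith) h1
    rw [div_le_div_iff₀ (by linarith) (by linarith)] at this
    linarith

/-! ### Constants of the calibration and their inequalities -/

/-- The increment of `ell` over `[k, k + 1]`. -/
def rise (ρ : ℝ) (k : ℤ) : ℝ := ell ρ (k + 1) - ell ρ k

/-- The value at `0` of the secant of `ell` through `k` and `k + 1`. -/
def intercept (ρ : ℝ) (k : ℤ) : ℝ := ell ρ k - k * rise ρ k

/-- The horizontal component of the unit vector in the direction `(1 - ρ, ρ)`. -/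
def tilt (ρ : ℝ) : ℝ := (1 - ρ) / ell ρ 1

/-- The slope of the potential across a square. -/
def steep (ρ : ℝ) (k : ℤ) : ℝ := (rise ρ k - tilt ρ * (1 - ρ)) / ρ

section
variable {ρ : ℝ} (hρ : ρ ∈ Set.Ioo (1 / 2 : ℝ) 1)
include hρ

lemma ell_pos (x : ℝ) : 0 < ell ρ x := slant_pos (by linarith [hρ.2]) _

omit hρ in
lemma ell_one_sq : ell ρ 1 ^ 2 = (1 - ρ) ^ 2 + ρ ^ 2 := by
  rw [ell_eq_slant, slant_sq]; ring

lemma ell_one_le_one : ell ρ 1 ≤ 1 := by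
  have := ell_one_sq (ρ := ρ)
  have := ell_pos hρ 1
  nlinarith [hρ.1, hρ.2]

lemma secant_le_ell (k m : ℤ) : intercept ρ k + rise ρ k * m ≤ ell ρ m := by
  have := convexOn_secant_le_int (convexOn_ell hρ.2) k m
  unfold intercept rise
  linarith

omit hρ in
lemma rise_le_one (k : ℤ) : rise ρ k ≤ 1 := by
  have := slant_le_add_abs (1 - ρ) (k - (1 - ρ)) (k + 1 - (1 - ρ))
  rw [show (k + 1 - (1 - ρ) - (k - (1 - ρ)) : ℝ) = 1 by ring, abs_one] at this
  simp only [rise, ell_eq_slant]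
  linarith

lemma rise_one_le {k : ℤ} (hk : 1 ≤ k) : ell ρ 2 - ell ρ 1 ≤ rise ρ k := by
  obtain rfl | h := hk.eq_or_lt
  · simp only [rise]; norm_num
  have h1 := convexOn_secant_le_int (convexOn_ell hρ.2) k 1
  have h2 := convexOn_secant_le_int (convexOn_ell hρ.2) 1 k
  have h3 : (1 : ℝ) < k := by exact_mod_cast h
  norm_num at h1 h2
  have : (ell ρ 2 - ell ρ 1) * (k - 1) ≤ rise ρ k * (k - 1) := by
    unfold rise; linarith
  exact le_of_mul_le_mul_right this (by linarith)

lemma tilt_mul_ell : tilt ρ * ell ρ 1 = 1 - ρ := div_mul_cancel₀ _ (ell_pos hρ 1).ne'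

lemma tilt_pos : 0 < tilt ρ := div_pos (by linarith [hρ.2]) (ell_pos hρ 1)

lemma le_tilt : 1 - ρ ≤ tilt ρ := by
  have h1 := tilt_mul_ell hρ
  nlinarith [ell_one_le_one hρ, tilt_pos hρ]

lemma tilt_sq_le : 2 * tilt ρ ^ 2 ≤ 1 := by
  have h1 := tilt_mul_ell hρ
  have h2 := ell_one_sq (ρ := ρ)
  have h3 := ell_pos hρ 1
  have h4 : 2 * tilt ρ ^ 2 * ell ρ 1 ^ 2 ≤ 1 * ell ρ 1 ^ 2 := by
    have : tilt ρ ^ 2 * ell ρ 1 ^ 2 = (1 - ρ) ^ 2 := by rw [← h1]; ring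
    nlinarith [hρ.1, hρ.2]
  exact le_of_mul_le_mul_right h4 (by positivity)

lemma tilt_lt_one : tilt ρ < 1 := by nlinarith [tilt_sq_le hρ, tilt_pos hρ]

/-- This is `steep ρ 1 ≥ 1` in disguise; by convexity it yields `one_le_steep` for every `k ≥ 1`. -/
lemma ell_two_lower : ell ρ 1 + ρ + tilt ρ * (1 - ρ) ≤ ell ρ 2 := by
  obtain ⟨d, rfl⟩ : ∃ d, ρ = 1 - d := ⟨1 - ρ, by ring⟩
  obtain ⟨h1, h2⟩ := hρ
  have hd0 : 0 < d := by linarith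
  have hd1 : d < 1 / 2 := by linarith
  have ha := ell_pos ⟨h1, h2⟩ 1
  have hc := tilt_mul_ell ⟨h1, h2⟩
  have hsq := ell_one_sq (ρ := 1 - d)
  simp only [sub_sub_cancel] at hc hsq ⊢
  set a := ell (1 - d) 1
  have hell2 : 2 - d + d ^ 2 / 4 ≤ ell (1 - d) 2 := by
    rw [ell_eq_slant, slant]
    apply Real.le_sqrt_of_sq_le
    rw [sub_sub_cancel]
    nlinarith [mul_pos hd0 hd0, mul_pos (mul_pos hd0 hd0) hd0,
      mul_pos (mul_pos (mul_pos hd0 hd0) hd0) (sub_pos.2 hd1)]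
  -- With `tilt = d / a`, this is `a + tilt * d ≤ 1 + d² / 4` multiplied by `a`. It is tight near `d
  -- = 1/2`, where the difference of squares is only `d⁶ / 8`.
  have hkey : a ^ 2 + d ^ 2 ≤ a * (1 + d ^ 2 / 4) := by
    refine le_of_sq_le_sq ?_ (by positivity)
    have h : (a * (1 + d ^ 2 / 4)) ^ 2 - (a ^ 2 + d ^ 2) ^ 2
        = d * ((1 - 2 * d) * (2 - 7 / 2 * d + 4 * d ^ 2) + d ^ 3 / 8 * (1 / 2 - d) + d ^ 5 / 8) := by
      rw [mul_pow, hsq]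
      ring
    have h' : 0 ≤ 2 - 7 / 2 * d + 4 * d ^ 2 := by nlinarith [sq_nonneg (d - 7 / 16)]
    have h0 : 0 ≤ 1 - 2 * d := by linarith
    have h3 : 0 ≤ 1 / 2 - d := by linarith
    have : 0 ≤ (a * (1 + d ^ 2 / 4)) ^ 2 - (a ^ 2 + d ^ 2) ^ 2 := by rw [h]; positivity
    linarith
  have : a + tilt (1 - d) * d ≤ 1 + d ^ 2 / 4 := by
    refine le_of_mul_le_mul_left ?_ ha
    nlinarith
  linarith

lemma one_le_steep {k : ℤ} (hk : 1 ≤ k) : 1 ≤ steep ρ k := by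
  rw [steep, le_div_iff₀ (by linarith [hρ.1])]
  linarith [rise_one_le hρ hk, ell_two_lower hρ]

lemma steep_mul (k : ℤ) : steep ρ k * ρ = rise ρ k - tilt ρ * (1 - ρ) :=
  div_mul_cancel₀ _ (by linarith [hρ.1])

/-- From `rise ≤ 1` and `tilt ≥ 1 - ρ` the slope is at most `2 - ρ`. The bound keeps the calibrating
field below `β` in the squares. -/
lemma steep_le (k : ℤ) : steep ρ k ≤ 3 / 2 := by
  rw [steep, div_le_iff₀ (by linarith [hρ.1])]
  nlinarith [rise_le_one k (ρ := ρ), le_tilt hρ, hρ.1, hρ.2]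

lemma rise_nonneg {k : ℤ} (hk : 1 ≤ k) : 0 ≤ rise ρ k := by
  have := rise_one_le hρ hk
  have := ell_two_lower hρ
  nlinarith [tilt_pos hρ, hρ.1, hρ.2]

lemma intercept_nonpos {k : ℤ} (hk : 1 ≤ k) : intercept ρ k ≤ 0 := by
  have h1 := secant_le_ell hρ k 1
  have h2 := rise_one_le hρ hk
  have h3 : 2 * ell ρ 1 ≤ ell ρ 2 := by
    refine le_of_sq_le_sq ?_ (ell_pos hρ 2).le
    have h4 : ell ρ 2 ^ 2 = (1 - ρ) ^ 2 + (1 + ρ) ^ 2 := by rw [ell_eq_slant, slant_sq]; ring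
    rw [mul_pow, ell_one_sq, h4]
    nlinarith [hρ.1, hρ.2]
  norm_num at h1
  linarith

/-- The crossing inequality for end points in the closed vertical strips. -/
lemma strip_crossing {k : ℤ} (hk : 1 ≤ k) (m : ℤ) {w : ℝ} (hw0 : 0 ≤ w) (hw : w ≤ 2 * (1 - ρ)) :
    intercept ρ k + rise ρ k * m + tilt ρ * w ≤ slant (1 - ρ) (m - (1 - ρ) + w) := by
  have hc := tilt_sq_le hρ
  have hc0 := tilt_pos hρ
  have hd : 0 < 1 - ρ := by linarith [hρ.2]
  have hd' : 1 - ρ < ρ := by linarith [hρ.1]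
  rcases le_or_gt 1 m with hm | hm
  · have h1 := secant_le_ell hρ k m
    rw [ell_eq_slant] at h1
    have hm' : (1 : ℝ) ≤ m := by exact_mod_cast hm
    set t := (m : ℝ) - (1 - ρ) with ht
    have hp := slant_pos hd t
    have h2 := inner_le_slant_mul (1 - ρ) t (t + w)
    have h3 := slant_sq (1 - ρ) t
    -- The derivative of `slant` at `t` is at least `tilt`, because `t ≥ ρ > 1 - ρ` and `2 * tilt² ≤
    -- 1`.
    have h4 : tilt ρ * slant (1 - ρ) t ≤ t := by
      refine le_of_sq_le_sq ?_ (by linarith)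
      rw [mul_pow, h3]
      nlinarith
    have h5 : slant (1 - ρ) t + tilt ρ * w ≤ slant (1 - ρ) (t + w) := by
      refine le_of_mul_le_mul_left ?_ hp
      nlinarith [mul_le_mul_of_nonneg_right h4 hw0]
    linarith
  · have h0 := intercept_nonpos hρ hk
    have hm' : (m : ℝ) ≤ 0 := by exact_mod_cast (by omega : m ≤ 0)
    have h1 : rise ρ k * m ≤ 0 := mul_nonpos_of_nonneg_of_nonpos (rise_nonneg hρ hk) hm'
    have h2 : tilt ρ * w ≤ slant (1 - ρ) (m - (1 - ρ) + w) := by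
      rcases eq_or_ne m 0 with rfl | hm0
      -- The test vectors `(tilt, ±tilt)` are admissible since `2 * tilt² ≤ 1`; with the plus sign
      -- the terms in `1 - ρ` cancel and leave `tilt * w`.
      · have := linear_le_slant (a := tilt ρ) (b := tilt ρ) (by linarith) (1 - ρ)
          ((0 : ℤ) - (1 - ρ) + w)
        push_cast at this ⊢
        linarith
      · have hm1 : (m : ℝ) ≤ -1 := by exact_mod_cast (by omega : m ≤ -1)
        have := linear_le_slant (a := tilt ρ) (b := -tilt ρ) (by linarith) (1 - ρ)
          (m - (1 - ρ) + w)
        nlinarith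
    linarith

end

/-! ### The potential and its comparison with strip crossings -/

/-- The measure of the part of `[0, x]` lying in the squares' columns, with a sign. -/
def squareMeasure (ρ x : ℝ) : ℝ := ρ * ⌊x⌋ + min (Int.fract x) ρ

lemma squareMeasure_diff_mem {ρ : ℝ} (hρ : ρ ∈ Set.Ioo (1 / 2 : ℝ) 1) {x y : ℝ} (h : x ≤ y) :
    squareMeasure ρ y - squareMeasure ρ x ∈ Set.Icc 0 (y - x) := by
  obtain ⟨h1, h2⟩ := hρ
  have hx := Int.floor_add_fract x
  have hy := Int.floor_add_fract y
  have hx0 := Int.fract_nonneg x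
  have hy0 := Int.fract_nonneg y
  have hx1 := Int.fract_lt_one x
  unfold squareMeasure
  obtain he | hl := (Int.floor_le_floor h).eq_or_lt
  · rw [he] at hx ⊢
    constructor <;> grind
  · have hl' : (⌊x⌋ : ℝ) + 1 ≤ ⌊y⌋ := by exact_mod_cast hl
    have : (1 - ρ) * 1 ≤ (1 - ρ) * (⌊y⌋ - ⌊x⌋) := by
      apply mul_le_mul_of_nonneg_left <;> linarith
    have h3 : ρ * 1 ≤ ρ * (⌊y⌋ - ⌊x⌋) := by
      apply mul_le_mul_of_nonneg_left <;> linarith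
    constructor <;> rcases min_cases (Int.fract x) ρ with h4 | h4 <;>
      rcases min_cases (Int.fract y) ρ with h5 | h5 <;> nlinarith

lemma squareMeasure_intCast {ρ : ℝ} (hρ : ρ ∈ Set.Ioo (1 / 2 : ℝ) 1) (n : ℤ) :
    squareMeasure ρ n = ρ * n := by
  simp [squareMeasure, show (0 : ℝ) ≤ ρ by linarith [hρ.1]]

lemma squareMeasure_of_mem_square {ρ x : ℝ} {n : ℤ} (hρ : ρ ≤ 1) (h : x ∈ Set.Ico (n : ℝ) (n + ρ)) :
    squareMeasure ρ x = ρ * n + (x - n) := by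
  have : ⌊x⌋ = n := Int.floor_eq_iff.2 ⟨h.1, by linarith [h.2]⟩
  rw [squareMeasure, ← Int.self_sub_floor, this, min_eq_left (by linarith [h.2])]

lemma squareMeasure_of_mem_strip {ρ x : ℝ} {n : ℤ} (hρ : ρ ∈ Set.Ioo (1 / 2 : ℝ) 1)
    (h : x ∈ Set.Icc (n + ρ) (n + 1)) : squareMeasure ρ x = ρ * (n + 1) := by
  obtain he | hl := h.2.eq_or_lt
  · rw [he]
    exact_mod_cast squareMeasure_intCast hρ (n + 1)
  have : ⌊x⌋ = n := Int.floor_eq_iff.2 ⟨by linarith [h.1, hρ.1], hl⟩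
  rw [squareMeasure, ← Int.self_sub_floor, this, min_eq_right (by linarith [h.1])]
  ring

/-- The calibrating potential on the horizontal axis. -/
def potential (ρ : ℝ) (k : ℤ) (x : ℝ) : ℝ :=
  tilt ρ * x + (steep ρ k - tilt ρ) * squareMeasure ρ x

section
variable {ρ : ℝ} (hρ : ρ ∈ Set.Ioo (1 / 2 : ℝ) 1) {k : ℤ}
include hρ

lemma potential_intCast (n : ℤ) : potential ρ k n = rise ρ k * n := by
  rw [potential, squareMeasure_intCast hρ]
  linear_combination n * steep_mul hρ k

lemma potential_of_mem_square {x : ℝ} {n : ℤ} (h : x ∈ Set.Ico (n : ℝ) (n + ρ)) :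
    potential ρ k x = potential ρ k n + steep ρ k * (x - n) := by
  rw [potential_intCast hρ, potential, squareMeasure_of_mem_square hρ.2.le h]
  linear_combination n * steep_mul hρ k

lemma potential_of_mem_strip {x : ℝ} {n : ℤ} (h : x ∈ Set.Icc (n + ρ) (n + 1)) :
    potential ρ k x = rise ρ k * (n + 1) - tilt ρ * (n + 1 - x) := by
  rw [potential, squareMeasure_of_mem_strip hρ h]
  linear_combination (n + 1) * steep_mul hρ k

omit hρ in
/-- A point of the line lies in the part of a period covered by a square or by a strip. -/
lemma exists_mem_square_or_strip (x : ℝ) :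
    ∃ n : ℤ, x ∈ Set.Ico (n : ℝ) (n + ρ) ∨ x ∈ Set.Icc (n + ρ) (n + 1) := by
  refine ⟨⌊x⌋, ?_⟩
  have h1 := Int.floor_le x
  have h2 := Int.lt_floor_add_one x
  rcases lt_or_ge x (⌊x⌋ + ρ) with h | h
  · exact Or.inl ⟨h1, h⟩
  · exact Or.inr ⟨h, h2.le⟩

/-- The potential does not increase faster than the length of a crossing of a horizontal strip. -/
lemma potential_crossing (hk : 1 ≤ k) (x₀ x₁ : ℝ) :
    potential ρ k x₁ - potential ρ k x₀ + (tilt ρ * (1 - ρ) + intercept ρ k)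
      ≤ slant (1 - ρ) (x₁ - x₀) := by
  have hσ := one_le_steep hρ hk
  have hd : 0 < 1 - ρ := by linarith [hρ.2]
  have strips : ∀ (m n : ℤ) (x₀ x₁ : ℝ), x₀ ∈ Set.Icc (m + ρ) (m + 1) → x₁ ∈ Set.Icc (n + ρ) (n + 1) →
      potential ρ k x₁ - potential ρ k x₀ + (tilt ρ * (1 - ρ) + intercept ρ k)
      ≤ slant (1 - ρ) (x₁ - x₀) := by
    intro m n x₀ x₁ h₀ h₁
    have := strip_crossing hρ hk (n - m) (w := (x₁ - (n + ρ)) + (m + 1 - x₀))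
      (by linarith [h₀.2, h₁.1]) (by linarith [h₀.1, h₁.2])
    rw [potential_of_mem_strip hρ h₀, potential_of_mem_strip hρ h₁]
    push_cast at this
    rw [show (n - m - (1 - ρ) + (x₁ - (n + ρ) + (m + 1 - x₀)) : ℝ) = x₁ - x₀ by ring] at this
    linarith
  have left : ∀ (n : ℤ) (x₀ x₁ : ℝ), x₁ ∈ Set.Icc (n + ρ) (n + 1) →
      potential ρ k x₁ - potential ρ k x₀ + (tilt ρ * (1 - ρ) + intercept ρ k)
      ≤ slant (1 - ρ) (x₁ - x₀) := by
    intro n x₀ x₁ h₁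
    obtain ⟨m, h | h⟩ := exists_mem_square_or_strip (ρ := ρ) x₀
    -- Slide `x₀` left to `m`, the right edge of the preceding strip. The potential changes at rate
    -- `steep ≥ 1`, the segment length at rate at most one, so the estimate at `m` implies the one
    -- at `x₀`.
    · have h2 := strips (m - 1) n m x₁ ⟨by push_cast; linarith, by push_cast; linarith⟩ h₁
      have h3 := slant_le_add_abs (1 - ρ) (x₁ - x₀) (x₁ - m)
      rw [abs_of_nonneg (by linarith [h.1])] at h3
      rw [potential_of_mem_square hρ h]
      nlinarith [h.1]
    · exact strips m n x₀ x₁ h h₁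
  obtain ⟨n, h | h⟩ := exists_mem_square_or_strip (ρ := ρ) x₁
  · have h2 := left n x₀ (n + ρ) ⟨le_rfl, by linarith⟩
    have h3 := slant_le_add_abs (1 - ρ) (x₁ - x₀) (n + ρ - x₀)
    rw [abs_of_nonneg (by linarith [h.2])] at h3
    rw [potential_of_mem_strip hρ ⟨le_rfl, by linarith⟩] at h2
    rw [potential_of_mem_square hρ h, potential_intCast hρ]
    nlinarith [h.2, steep_mul hρ k]
  · exact left n x₀ x₁ h

/-- Both sides agree at integers, and over a period the slope is first `steep ≥ 1 ≥ rise`, then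
`tilt ≤ rise`. -/
lemma rise_mul_le_potential (hk : 1 ≤ k) (x : ℝ) : rise ρ k * x ≤ potential ρ k x := by
  have hσ := one_le_steep hρ hk
  have hc := tilt_lt_one hρ
  have hr := steep_mul hρ k
  obtain ⟨n, h | h⟩ := exists_mem_square_or_strip (ρ := ρ) x
  · rw [potential_of_mem_square hρ h, potential_intCast hρ]
    nlinarith [h.1, rise_le_one k (ρ := ρ)]
  · rw [potential_of_mem_strip hρ h]
    have : tilt ρ ≤ rise ρ k := by nlinarith [hρ.1]
    nlinarith [h.2]

/-- Pays for the last piece of a curve, after height `N` is reached, by its horizontal displacement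
alone. -/
lemma potential_intCast_sub_le (hk : 1 ≤ k) (n : ℤ) (x : ℝ) :
    potential ρ k n - potential ρ k x ≤ |n - x| := by
  have h1 := rise_mul_le_potential hρ hk x
  rw [potential_intCast hρ]
  have h2 : rise ρ k * (n - x) ≤ rise ρ k * |n - x| :=
    mul_le_mul_of_nonneg_left (le_abs_self _) (rise_nonneg hρ hk)
  nlinarith [rise_le_one k (ρ := ρ), abs_nonneg (n - x)]

end

end TwoPhase

end

/-! ### Absolutely continuous curves, the coefficient and the length functional -/

noncomputable section

open MeasureTheory Filter Topology

/-- The composition of a Lipschitz function with an absolutely continuous one is absolutely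
continuous. -/
lemma LipschitzWith.comp_absolutelyContinuousOnInterval {X Y : Type*} [PseudoMetricSpace X]
    [PseudoMetricSpace Y] {K : NNReal} {g : X → Y} (hg : LipschitzWith K g) {f : ℝ → X} {a b : ℝ}
    (hf : AbsolutelyContinuousOnInterval f a b) :
    AbsolutelyContinuousOnInterval (g ∘ f) a b := by
  refine squeeze_zero (fun t => Finset.sum_nonneg fun i _ => dist_nonneg) (fun t => ?_)
    (by simpa using Tendsto.const_mul (K : ℝ) hf)
  rw [Finset.mul_sum]
  exact Finset.sum_le_sum fun i _ => hg.dist_le_mul _ _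

/-- The fundamental theorem of calculus as an inequality, for absolutely continuous functions. -/
lemma AbsolutelyContinuousOnInterval.sub_le_integral {g w : ℝ → ℝ} {a b : ℝ} (hab : a ≤ b)
    (hg : AbsolutelyContinuousOnInterval g a b) (hw : IntervalIntegrable w volume a b)
    (h : ∀ᵐ t, t ∈ Set.Ioo a b → deriv g t ≤ w t) : g b - g a ≤ ∫ t in a..b, w t := by
  rw [← hg.integral_deriv_eq_sub]
  refine intervalIntegral.integral_mono_ae_restrict hab hg.intervalIntegrable_deriv hw ?_
  rw [← Measure.restrict_congr_set Ioo_ae_eq_Icc]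
  exact (ae_restrict_iff' measurableSet_Ioo).2 h

namespace TwoPhase

lemma shiftedCoeff_of_mem {ρ β : ℝ} (hρ : ρ ∈ Set.Ioo (1 / 2 : ℝ) 1) {p : Plane}
    (h0 : Int.fract (p 0) ∈ Set.Ioo 0 ρ) (h1 : Int.fract (p 1) ∈ Set.Ioo (1 - ρ) 1) :
    shiftedCoeff ρ β p = β := by
  obtain ⟨hρ0, hρ1⟩ := hρ
  obtain ⟨a, b⟩ := h0
  obtain ⟨c, d⟩ := h1
  have e0 : Int.fract (p 0 + (1 - ρ) / 2) = Int.fract (p 0) + (1 - ρ) / 2 := by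
    refine Int.fract_eq_iff.2 ⟨by linarith, by linarith, ⌊p 0⌋, ?_⟩
    rw [← Int.self_sub_floor]; ring
  have e1 : Int.fract (p 1 - (1 - ρ) / 2) = Int.fract (p 1) - (1 - ρ) / 2 := by
    refine Int.fract_eq_iff.2 ⟨by linarith, by linarith, ⌊p 1⌋, ?_⟩
    rw [← Int.self_sub_floor]; ring
  simp only [shiftedCoeff, coeff]
  refine if_pos ⟨?_, ?_⟩
  · simp [e0]; constructor <;> linarith
  · simp [e1]; constructor <;> linarith

lemma shiftedCoeff_of_fract_fst {ρ β : ℝ} (hρ : ρ ∈ Set.Ioo (1 / 2 : ℝ) 1) {p : Plane}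
    (h0 : Int.fract (p 0) ∉ Set.Ioo 0 ρ) : shiftedCoeff ρ β p = 1 := by
  obtain ⟨hρ0, hρ1⟩ := hρ
  simp only [shiftedCoeff, coeff]
  refine if_neg fun h => h0 ?_
  have h := h.1
  simp only [Matrix.cons_val_zero, Set.mem_Ioo] at h
  have ha := Int.fract_nonneg (p 0)
  have hb := Int.fract_lt_one (p 0)
  rcases lt_or_ge (Int.fract (p 0) + (1 - ρ) / 2) 1 with hl | hl
  · have e0 : Int.fract (p 0 + (1 - ρ) / 2) = Int.fract (p 0) + (1 - ρ) / 2 := by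
      refine Int.fract_eq_iff.2 ⟨by linarith, hl, ⌊p 0⌋, ?_⟩
      rw [← Int.self_sub_floor]; ring
    rw [e0] at h
    exact ⟨by linarith, by linarith⟩
  · have e0 : Int.fract (p 0 + (1 - ρ) / 2) = Int.fract (p 0) + (1 - ρ) / 2 - 1 := by
      refine Int.fract_eq_iff.2 ⟨by linarith, by linarith, ⌊p 0⌋ + 1, ?_⟩
      rw [← Int.self_sub_floor]; push_cast; ring
    rw [e0] at h
    exact absurd h.1 (by linarith)

lemma shiftedCoeff_of_fract_snd {ρ β : ℝ} (hρ : ρ ∈ Set.Ioo (1 / 2 : ℝ) 1) {p : Plane}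
    (h1 : Int.fract (p 1) ≤ 1 - ρ) : shiftedCoeff ρ β p = 1 := by
  obtain ⟨hρ0, hρ1⟩ := hρ
  simp only [shiftedCoeff, coeff]
  refine if_neg fun h => ?_
  have h := h.2
  simp only [Matrix.cons_val_one, Matrix.cons_val_fin_one, Set.mem_Ioo] at h
  have ha := Int.fract_nonneg (p 1)
  rcases lt_or_ge (Int.fract (p 1)) ((1 - ρ) / 2) with hl | hl
  · have e1 : Int.fract (p 1 - (1 - ρ) / 2) = Int.fract (p 1) - (1 - ρ) / 2 + 1 := by
      refine Int.fract_eq_iff.2 ⟨by linarith, by linarith, ⌊p 1⌋ - 1, ?_⟩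
      rw [← Int.self_sub_floor]; push_cast; ring
    rw [e1] at h
    linarith [h.2]
  · have e1 : Int.fract (p 1 - (1 - ρ) / 2) = Int.fract (p 1) - (1 - ρ) / 2 := by
      refine Int.fract_eq_iff.2 ⟨by linarith, by linarith, ⌊p 1⌋, ?_⟩
      rw [← Int.self_sub_floor]; ring
    rw [e1] at h
    linarith [h.1]

lemma measurable_coeff (ρ β : ℝ) : Measurable (coeff ρ β) := by
  classical
  refine Measurable.ite (MeasurableSet.inter ?_ ?_) measurable_const measurable_const
  · exact (measurable_fract.comp (EuclideanSpace.proj (𝕜 := ℝ) (0 : Fin 2)).continuous.measurable)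
      measurableSet_Ioo
  · exact (measurable_fract.comp (EuclideanSpace.proj (𝕜 := ℝ) (1 : Fin 2)).continuous.measurable)
      measurableSet_Ioo

lemma shiftedCoeff_eq_coeff_add (ρ β : ℝ) (p : Plane) :
    shiftedCoeff ρ β p = coeff ρ β (p + !₂[(1 - ρ) / 2, -((1 - ρ) / 2)]) := by
  unfold shiftedCoeff
  congr 1
  ext i
  fin_cases i <;> simp [sub_eq_add_neg]

lemma measurable_shiftedCoeff (ρ β : ℝ) : Measurable (shiftedCoeff ρ β) := by
  rw [funext (shiftedCoeff_eq_coeff_add ρ β)]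
  exact (measurable_coeff ρ β).comp (measurable_id.add_const _)

lemma shiftedCoeff_mem {β : ℝ} (ρ : ℝ) (hβ : 1 ≤ β) (p : Plane) :
    shiftedCoeff ρ β p ∈ Set.Icc 1 β := by
  unfold shiftedCoeff coeff
  split_ifs
  · exact ⟨hβ, le_rfl⟩
  · exact ⟨le_rfl, hβ⟩

/-- The integrand of the length functional. -/
def speed (ρ β : ℝ) (γ : ℝ → Plane) (t : ℝ) : ℝ := shiftedCoeff ρ β (γ t) * ‖deriv γ t‖

/-- The calibration condition: a covector `(u, v)` is dominated by the metric wherever its norm is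
at most the coefficient `K`. -/
lemma linear_le_mul_norm {u v K : ℝ} (hK : 0 ≤ K) (h : u ^ 2 + v ^ 2 ≤ K ^ 2) (p : Plane) :
    u * p 0 + v * p 1 ≤ K * ‖p‖ := by
  have hp : ‖p‖ ^ 2 = p 0 ^ 2 + p 1 ^ 2 := by
    rw [EuclideanSpace.norm_sq_eq, Fin.sum_univ_two]
    simp
  refine le_of_sq_le_sq ?_ (by positivity)
  rw [mul_pow, hp]
  nlinarith [sq_nonneg (u * p 1 - v * p 0),
    mul_le_mul_of_nonneg_right h (by positivity : 0 ≤ p 0 ^ 2 + p 1 ^ 2)]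

lemma norm_le_abs_add_abs (p : Plane) : ‖p‖ ≤ |p 0| + |p 1| := by
  rw [EuclideanSpace.norm_eq, Fin.sum_univ_two]
  refine Real.sqrt_le_iff.2 ⟨by positivity, ?_⟩
  simp only [Real.norm_eq_abs]
  nlinarith [abs_nonneg (p 0), abs_nonneg (p 1)]

section
variable {γ : ℝ → Plane} {a b : ℝ} (hγ : AbsolutelyContinuousOnInterval γ a b)
include hγ

lemma coord_absolutelyContinuous (i : Fin 2) :
    AbsolutelyContinuousOnInterval (fun t => γ t i) a b :=
  (EuclideanSpace.proj (𝕜 := ℝ) i).lipschitz.comp_absolutelyContinuousOnInterval hγ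

lemma ae_hasDerivAt_coord :
    ∀ᵐ t, t ∈ Set.uIcc a b → ∀ i, HasDerivAt (fun s => γ s i) (deriv γ t i) t := by
  filter_upwards [(coord_absolutelyContinuous hγ 0).ae_differentiableAt,
    (coord_absolutelyContinuous hγ 1).ae_differentiableAt] with t h0 h1 ht i
  have hd : DifferentiableAt ℝ γ t := by
    rw [differentiableAt_euclidean]
    intro i
    fin_cases i
    · exact h0 ht
    · exact h1 ht
  exact (EuclideanSpace.proj (𝕜 := ℝ) i).hasFDerivAt.comp_hasDerivAt t hd.hasDerivAt

lemma intervalIntegrable_speed (ρ : ℝ) {β : ℝ} (hβ : 1 ≤ β) :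
    IntervalIntegrable (speed ρ β γ) volume a b := by
  have h0 := (coord_absolutelyContinuous hγ 0).intervalIntegrable_deriv
  have h1 := (coord_absolutelyContinuous hγ 1).intervalIntegrable_deriv
  refine ((h0.norm.add h1.norm).const_mul β).mono_fun' ?_ ?_
  · have hc : AEMeasurable γ (volume.restrict (Set.uIoc a b)) :=
      (hγ.continuousOn.mono Set.uIoc_subset_uIcc).aemeasurable measurableSet_uIoc
    exact (((measurable_shiftedCoeff ρ β).comp_aemeasurable hc).mul
      (measurable_deriv γ).norm.aemeasurable).aestronglyMeasurable
  · refine (ae_restrict_iff' measurableSet_uIoc).2 ?_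
    filter_upwards [ae_hasDerivAt_coord hγ] with t ht htm
    have ht := ht (Set.uIoc_subset_uIcc htm)
    have hA := shiftedCoeff_mem ρ hβ (γ t)
    have hA0 : 0 ≤ shiftedCoeff ρ β (γ t) := by linarith [hA.1]
    rw [speed, Real.norm_of_nonneg (by positivity), (ht 0).deriv, (ht 1).deriv]
    exact mul_le_mul hA.2 (norm_le_abs_add_abs _) (norm_nonneg _) (by linarith)

/-- The length of a curve is at least the increment of any linear function of slope one. -/
lemma linear_sub_le_length (ρ : ℝ) {β : ℝ} (hβ : 1 ≤ β) (hab : a ≤ b) {u v : ℝ}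
    (huv : u ^ 2 + v ^ 2 ≤ 1) :
    u * (γ b 0 - γ a 0) + v * (γ b 1 - γ a 1) ≤ ∫ t in a..b, speed ρ β γ t := by
  have hg : AbsolutelyContinuousOnInterval (fun t => u * γ t 0 + v * γ t 1) a b :=
    ((coord_absolutelyContinuous hγ 0).const_mul u).add
      ((coord_absolutelyContinuous hγ 1).const_mul v)
  have := hg.sub_le_integral hab (intervalIntegrable_speed hγ ρ hβ) (by
    filter_upwards [ae_hasDerivAt_coord hγ] with t ht htm
    have ht := ht (by rw [Set.uIcc_of_le hab]; exact Set.Ioo_subset_Icc_self htm)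
    rw [(((ht 0).const_mul u).fun_add ((ht 1).const_mul v)).deriv]
    refine (linear_le_mul_norm zero_le_one (by simpa using huv) _).trans ?_
    exact mul_le_mul_of_nonneg_right (shiftedCoeff_mem ρ hβ (γ t)).1 (norm_nonneg _))
  linarith

/-- Since the coefficient is at least one, test with the unit vector along the displacement. -/
lemma slant_le_length (ρ : ℝ) {β : ℝ} (hβ : 1 ≤ β) (hab : a ≤ b) :
    slant (γ b 1 - γ a 1) (γ b 0 - γ a 0) ≤ ∫ t in a..b, speed ρ β γ t := by
  set t := γ b 0 - γ a 0 with ht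
  set d := γ b 1 - γ a 1 with hd
  have hs := slant_sq d t
  rcases (slant_nonneg d t).eq_or_lt with h | h
  · have := linear_sub_le_length hγ ρ hβ hab (u := 0) (v := 0) (by norm_num)
    rw [← h]
    linarith
  · have := linear_sub_le_length hγ ρ hβ hab (u := t / slant d t) (v := d / slant d t) (by
      rw [div_pow, div_pow, ← add_div, hs, add_comm, div_self (by rw [← hs]; positivity)])
    refine le_trans (le_of_eq ?_) this
    rw [← ht, ← hd]
    field_simp
    linarith

end

/-! ### The calibration along curves -/

section
variable {ρ : ℝ} (hρ : ρ ∈ Set.Ioo (1 / 2 : ℝ) 1)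
include hρ

lemma lipschitzWith_squareMeasure : LipschitzWith 1 (squareMeasure ρ) := by
  refine LipschitzWith.of_dist_le_mul fun x y => ?_
  rw [NNReal.coe_one, one_mul, Real.dist_eq, Real.dist_eq]
  rcases le_total x y with h | h
  · have := squareMeasure_diff_mem hρ h
    rw [abs_sub_comm, abs_of_nonneg this.1, abs_sub_comm, abs_of_nonneg (by linarith)]
    exact this.2
  · have := squareMeasure_diff_mem hρ h
    rw [abs_of_nonneg this.1, abs_of_nonneg (by linarith)]
    exact this.2

lemma squareMeasure_mono : Monotone (squareMeasure ρ) :=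
  fun _ _ h => sub_nonneg.1 (squareMeasure_diff_mem hρ h).1

/-- The chain rule for `squareMeasure`, in the interior of the squares' columns. -/
lemma hasDerivAt_squareMeasure_comp_of_mem {f : ℝ → ℝ} {f' t : ℝ} (hf : HasDerivAt f f' t)
    (h : Int.fract (f t) ∈ Set.Ioo 0 ρ) : HasDerivAt (fun s => squareMeasure ρ (f s)) f' t := by
  rw [← Int.self_sub_floor] at h
  have hev : ∀ᶠ s in 𝓝 t, f s ∈ Set.Ioo (⌊f t⌋ : ℝ) (⌊f t⌋ + ρ) :=
    hf.continuousAt.eventually (Ioo_mem_nhds (by linarith [h.1]) (by linarith [h.2]))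
  have h2 : HasDerivAt (fun s => ρ * ⌊f t⌋ + (f s - ⌊f t⌋)) f' t := (hf.sub_const _).const_add _
  refine h2.congr_of_eventuallyEq ?_
  filter_upwards [hev] with s hs
  exact squareMeasure_of_mem_square hρ.2.le ⟨hs.1.le, hs.2⟩

/-- Wherever `squareMeasure ∘ f` is differentiable, its derivative vanishes off the open columns. -/
lemma deriv_squareMeasure_comp_of_notMem {f : ℝ → ℝ} {t : ℝ} (hf : ContinuousAt f t)
    (h : Int.fract (f t) ∉ Set.Ioo 0 ρ) : deriv (fun s => squareMeasure ρ (f s)) t = 0 := by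
  have h0 := Int.fract_nonneg (f t)
  have h1 := Int.fract_lt_one (f t)
  have hfl := Int.floor_add_fract (f t)
  rcases h0.eq_or_lt with h2 | h2
  -- At an integer `squareMeasure` is flat on the left and nondecreasing on the right, so the
  -- composite has a local minimum whatever the direction of `f`. In the other case it is a local
  -- maximum. This replaces a chain rule at the corners.
  · refine IsLocalMin.deriv_eq_zero ?_
    have hev : ∀ᶠ s in 𝓝 t, f s ∈ Set.Ioi (f t - (1 - ρ)) :=
      hf.eventually (Ioi_mem_nhds (by linarith [hρ.2]))
    filter_upwards [hev] with s hs
    have hs : f t - (1 - ρ) < f s := hs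
    rcases le_total (f t) (f s) with h3 | h3
    · exact squareMeasure_mono hρ h3
    · have hft : f t = (⌊f t⌋ : ℤ) := by linarith
      rw [squareMeasure_of_mem_strip hρ (n := ⌊f t⌋ - 1) (x := f s)
        ⟨by push_cast; linarith, by push_cast; linarith⟩, hft, squareMeasure_intCast hρ]
      push_cast
      simp
  · have h3 : ρ ≤ Int.fract (f t) := by
      by_contra hc
      exact h ⟨h2, not_le.1 hc⟩
    refine IsLocalMax.deriv_eq_zero ?_
    have hev : ∀ᶠ s in 𝓝 t, f s ∈ Set.Iio (⌊f t⌋ + 1 : ℝ) :=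
      hf.eventually (Iio_mem_nhds (by linarith))
    filter_upwards [hev] with s hs
    have hs : f s < ⌊f t⌋ + 1 := hs
    rcases le_total (f s) (f t) with h4 | h4
    · exact squareMeasure_mono hρ h4
    · rw [squareMeasure_of_mem_strip hρ (n := ⌊f t⌋) (x := f s) ⟨by linarith, by linarith⟩,
        squareMeasure_of_mem_strip hρ (n := ⌊f t⌋) (x := f t) ⟨by linarith, by linarith⟩]

/-- A curve crossing the band between two consecutive horizontal strips is at least as long as
the increment of the calibration. -/
lemma band_crossing {β : ℝ} (hβ : 2 < β) {k : ℤ} (hk : 1 ≤ k) {γ : ℝ → Plane} {a b : ℝ}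
    (hγ : AbsolutelyContinuousOnInterval γ a b) (hab : a ≤ b) {j : ℤ}
    (hj : ∀ t ∈ Set.Ioo a b, γ t 1 ∈ Set.Ioo (j + (1 - ρ)) (j + 1)) :
    potential ρ k (γ b 0) - potential ρ k (γ a 0) + ρ / ell ρ 1 * (γ b 1 - γ a 1)
      ≤ ∫ t in a..b, speed ρ β γ t := by
  set q := ρ / ell ρ 1 with hq
  have hell := ell_pos hρ 1
  have hunit : tilt ρ ^ 2 + q ^ 2 = 1 := by
    rw [hq, tilt, div_pow, div_pow, ← add_div, ← ell_one_sq, div_self (by positivity)]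
  have hX := coord_absolutelyContinuous hγ 0
  have hS : AbsolutelyContinuousOnInterval (fun t => squareMeasure ρ (γ t 0)) a b :=
    (lipschitzWith_squareMeasure hρ).comp_absolutelyContinuousOnInterval hX
  have hg : AbsolutelyContinuousOnInterval (fun t => tilt ρ * γ t 0 + (steep ρ k - tilt ρ) *
      squareMeasure ρ (γ t 0) + q * γ t 1) a b :=
    ((hX.const_mul _).add (hS.const_mul _)).add ((coord_absolutelyContinuous hγ 1).const_mul q)
  have := hg.sub_le_integral hab (intervalIntegrable_speed hγ ρ (by linarith : 1 ≤ β)) (by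
    filter_upwards [ae_hasDerivAt_coord hγ, hS.ae_differentiableAt] with t ht hSt htm
    have htu : t ∈ Set.uIcc a b := by rw [Set.uIcc_of_le hab]; exact Set.Ioo_subset_Icc_self htm
    have ht := ht htu
    have hSt := (hSt htu).hasDerivAt
    have hy := hj t htm
    have hfl : ⌊γ t 1⌋ = j := Int.floor_eq_iff.2 ⟨by linarith [hy.1, hρ.2], hy.2⟩
    rw [((((ht 0).const_mul _).fun_add (hSt.const_mul _)).fun_add ((ht 1).const_mul q)).deriv, speed]
    by_cases hx : Int.fract (γ t 0) ∈ Set.Ioo 0 ρ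
    · rw [(hasDerivAt_squareMeasure_comp_of_mem hρ (ht 0) hx).deriv,
        shiftedCoeff_of_mem hρ hx (by
          rw [← Int.self_sub_floor, hfl]; exact ⟨by linarith [hy.1], by linarith [hy.2]⟩)]
      have h1 := one_le_steep hρ hk
      have h2 := steep_le hρ k
      have := linear_le_mul_norm (u := steep ρ k) (v := q) (K := β) (by linarith)
        (by nlinarith [tilt_pos hρ]) (deriv γ t)
      linarith
    · rw [deriv_squareMeasure_comp_of_notMem hρ (ht 0).continuousAt hx,
        shiftedCoeff_of_fract_fst hρ hx]
      have := linear_le_mul_norm (u := tilt ρ) (v := q) (K := 1) zero_le_one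
        (by linarith) (deriv γ t)
      linarith)
  unfold potential
  linarith

/-- The least length needed to ascend by one period, up to the increment of the potential. -/
lemma level_crossing {β : ℝ} (hβ : 2 < β) {k : ℤ} (hk : 1 ≤ k) {γ : ℝ → Plane} {a b : ℝ}
    (hγ : AbsolutelyContinuousOnInterval γ a b) (hab : a ≤ b) {j : ℤ} (ha : γ a 1 = j)
    (hb : γ b 1 = j + 1) (hj : ∀ t ∈ Set.Ico a b, γ t 1 < j + 1) :
    potential ρ k (γ b 0) - potential ρ k (γ a 0) + (ell ρ 1 + intercept ρ k)
      ≤ ∫ t in a..b, speed ρ β γ t := by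
  have hcont : ContinuousOn (fun t => γ t 1) (Set.Icc a b) := by
    have := (coord_absolutelyContinuous hγ 1).continuousOn
    rwa [Set.uIcc_of_le hab] at this
  have hd : 0 < 1 - ρ := by linarith [hρ.2]
  have hd1 : 0 < ρ := by linarith [hρ.1]
  -- `c` is the last time at or below the top of the horizontal strip. Before `c` only end points
  -- count, so dips below height `j` are harmless; between `c` and `b` the curve stays in the band.
  obtain ⟨c, ⟨hc, hcy⟩, hmax⟩ : ∃ c, IsGreatest (Set.Icc a b ∩ (fun t => γ t 1) ⁻¹'
      Set.Iic (j + (1 - ρ))) c := by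
    refine (isCompact_Icc.of_isClosed_subset
      (hcont.preimage_isClosed_of_isClosed isClosed_Icc isClosed_Iic)
      Set.inter_subset_left).exists_isGreatest ⟨a, ⟨le_rfl, hab⟩, ?_⟩
    simp only [Set.mem_preimage, Set.mem_Iic, ha]
    linarith
  have hafter : ∀ t ∈ Set.Ioc c b, j + (1 - ρ) < γ t 1 := by
    intro t ht
    by_contra hcon
    exact absurd (hmax ⟨⟨hc.1.trans ht.1.le, ht.2⟩, not_lt.1 hcon⟩) (not_le.2 ht.1)
  have hcy' : γ c 1 = j + (1 - ρ) := by
    refine le_antisymm hcy ?_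
    have hcy : γ c 1 ≤ j + (1 - ρ) := hcy
    obtain ⟨t, ht, hty⟩ := intermediate_value_Icc hc.2 (hcont.mono (Set.Icc_subset_Icc_left hc.1))
      (show j + (1 - ρ) ∈ Set.Icc (γ c 1) (γ b 1) from ⟨hcy, by rw [hb]; linarith⟩)
    rcases ht.1.eq_or_lt with h | h
    · rw [h]; exact hty.ge
    · exact absurd hty (hafter t ⟨h, ht.2⟩).ne'
  have hac := hγ.mono (c := a) (d := c) (by
    rw [Set.uIcc_of_le hab, Set.uIcc_of_le hc.1]; exact Set.Icc_subset_Icc_right hc.2)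
  have hcb := hγ.mono (c := c) (d := b) (by
    rw [Set.uIcc_of_le hab, Set.uIcc_of_le hc.2]; exact Set.Icc_subset_Icc_left hc.1)
  have hβ1 : 1 ≤ β := by linarith
  rw [← intervalIntegral.integral_add_adjacent_intervals (intervalIntegrable_speed hac ρ hβ1)
    (intervalIntegrable_speed hcb ρ hβ1)]
  have h1 := slant_le_length hac ρ hβ1 hc.1
  have h2 := band_crossing hρ hβ hk hcb hc.2 (j := j)
    (fun t ht => ⟨hafter t ⟨ht.1, ht.2.le⟩, hj t ⟨hc.1.trans ht.1.le, ht.2⟩⟩)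
  have h3 := potential_crossing hρ hk (γ a 0) (γ c 0)
  rw [show γ c 1 - γ a 1 = 1 - ρ by rw [hcy', ha]; ring] at h1
  rw [show γ b 1 - γ c 1 = ρ by rw [hcy', hb]; ring] at h2
  have h4 : tilt ρ * (1 - ρ) + ρ / ell ρ 1 * ρ = ell ρ 1 := by
    have := ell_pos hρ 1
    rw [tilt]
    field_simp
    linarith [ell_one_sq (ρ := ρ)]
  linarith

/-- Every admissible curve is at least as long as the increment of the calibration. -/
lemma length_lower_bound {β : ℝ} (hβ : 2 < β) {k : ℤ} (hk : 1 ≤ k) {γ : ℝ → Plane} {M : ℤ} {N : ℕ}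
    (hγ : γ ∈ admissible !₂[0, 0] !₂[(M : ℝ), (N : ℝ)]) :
    rise ρ k * M + N * (ell ρ 1 + intercept ρ k) ≤ curveLength ρ β γ := by
  obtain ⟨hγ, h0, h1⟩ := hγ
  have h00 : γ 0 0 = 0 := by simp [h0]
  have h01 : γ 0 1 = 0 := by simp [h0]
  have h10 : γ 1 0 = M := by simp [h1]
  have h11 : γ 1 1 = N := by simp [h1]
  have hβ1 : 1 ≤ β := by linarith
  have hsub : ∀ {c d : ℝ}, 0 ≤ c → c ≤ d → d ≤ 1 → AbsolutelyContinuousOnInterval γ c d := by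
    intro c d hc hcd hd
    refine hγ.mono ?_
    rw [Set.uIcc_of_le hcd, Set.uIcc_of_le zero_le_one]
    exact Set.Icc_subset_Icc hc hd
  have hint : ∀ {c d : ℝ}, 0 ≤ c → c ≤ d → d ≤ 1 →
      IntervalIntegrable (speed ρ β γ) volume c d :=
    fun hc hcd hd => intervalIntegrable_speed (hsub hc hcd hd) ρ hβ1
  have hcont : ContinuousOn (fun t => γ t 1) (Set.Icc 0 1) := by
    have := (coord_absolutelyContinuous hγ 1).continuousOn
    rwa [Set.uIcc_of_le zero_le_one] at this
  -- Each new time is the first one, after the previous, at which the next integer height is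
  -- reached; the row estimates telescope.
  have key : ∀ j : ℕ, j ≤ N → ∃ t ∈ Set.Icc (0 : ℝ) 1, γ t 1 = j ∧
      potential ρ k (γ t 0) + j * (ell ρ 1 + intercept ρ k) ≤ ∫ s in (0 : ℝ)..t, speed ρ β γ s := by
    intro j
    induction j with
    | zero =>
      intro _
      refine ⟨0, by simp, by simp [h01], ?_⟩
      have := potential_intCast hρ (k := k) 0
      simp only [Int.cast_zero, mul_zero] at this
      simp [h00, this]
    | succ j ih =>
      intro hjN
      obtain ⟨a, ha, hay, hal⟩ := ih (by omega)
      have hjN' : (j : ℝ) + 1 ≤ N := by exact_mod_cast hjN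
      have hcont' := hcont.mono (Set.Icc_subset_Icc_left ha.1)
      obtain ⟨b, ⟨hb, hby⟩, hmin⟩ : ∃ b, IsLeast (Set.Icc a 1 ∩ (fun t => γ t 1) ⁻¹'
          Set.Ici (j + 1 : ℝ)) b := by
        refine (isCompact_Icc.of_isClosed_subset
          (hcont'.preimage_isClosed_of_isClosed isClosed_Icc isClosed_Ici)
          Set.inter_subset_left).exists_isLeast ⟨1, ⟨ha.2, le_rfl⟩, ?_⟩
        simpa [h11] using hjN'
      have hbefore : ∀ t ∈ Set.Ico a b, γ t 1 < j + 1 := by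
        intro t ht
        by_contra hcon
        exact absurd (hmin ⟨⟨ht.1, ht.2.le.trans hb.2⟩, not_lt.1 hcon⟩) (not_le.2 ht.2)
      have hby' : γ b 1 = j + 1 := by
        refine le_antisymm ?_ hby
        obtain ⟨t, ht, hty⟩ := intermediate_value_Icc hb.1
          (hcont'.mono (Set.Icc_subset_Icc_right hb.2))
          (show (j + 1 : ℝ) ∈ Set.Icc (γ a 1) (γ b 1) from ⟨by rw [hay]; linarith, hby⟩)
        rcases ht.2.eq_or_lt with h | h
        · rw [← h]; exact hty.le
        · exact absurd hty (hbefore t ⟨ht.1, h⟩).ne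
      refine ⟨b, ⟨ha.1.trans hb.1, hb.2⟩, by push_cast; exact hby', ?_⟩
      rw [← intervalIntegral.integral_add_adjacent_intervals (hint le_rfl ha.1 ha.2)
        (hint ha.1 hb.1 hb.2)]
      have := level_crossing hρ hβ hk (hsub ha.1 hb.1 hb.2) hb.1 (j := j)
        (by simpa using hay) (by simpa using hby') (by simpa using hbefore)
      push_cast
      linarith
  obtain ⟨t, ht, hty, htl⟩ := key N le_rfl
  have hlast := slant_le_length (hsub ht.1 ht.2 le_rfl) ρ hβ1 ht.2
  have habs := (abs_le_slant (γ 1 1 - γ t 1) (γ 1 0 - γ t 0)).trans hlast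
  have hpot := potential_intCast_sub_le hρ hk M (γ t 0)
  rw [potential_intCast hρ] at hpot
  rw [h10] at habs
  have htot := intervalIntegral.integral_add_adjacent_intervals (hint le_rfl ht.1 ht.2)
    (hint ht.1 ht.2 le_rfl)
  have : curveLength ρ β γ = ∫ s in (0 : ℝ)..1, speed ρ β γ s := rfl
  linarith

end

end TwoPhase

end

/-! ### The explicit competitor -/

noncomputable section

open MeasureTheory Filter Topology

namespace TwoPhase

/-- A Lipschitz curve of length `L` joins `p` to `q`. -/
def Joined (ρ β : ℝ) (p q : Plane) (L : ℝ) : Prop :=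
  ∃ γ : ℝ → Plane, (∃ K, LipschitzWith K γ) ∧ γ 0 = p ∧ γ 1 = q ∧ curveLength ρ β γ = L

section
variable {ρ β : ℝ}

lemma Joined.refl (p : Plane) : Joined ρ β p p 0 :=
  ⟨fun _ => p, ⟨0, LipschitzWith.const p⟩, rfl, rfl, by simp [curveLength]⟩

lemma Joined.segment {p q : Plane}
    (h : ∀ t ∈ Set.Icc (0 : ℝ) 1, shiftedCoeff ρ β (p + t • (q - p)) = 1) :
    Joined ρ β p q ‖q - p‖ := by
  refine ⟨fun t => p + t • (q - p), ⟨_, ((LipschitzWith.const p).add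
    ((ContinuousLinearMap.id ℝ ℝ).smulRight (q - p)).lipschitz)⟩, by simp, by simp, ?_⟩
  have hd : ∀ t : ℝ, deriv (fun t : ℝ => p + t • (q - p)) t = q - p := fun t => by
    simpa using (((hasDerivAt_id t).smul_const (q - p)).const_add p).deriv
  rw [curveLength]
  simp only [hd]
  rw [intervalIntegral.integral_congr (g := fun _ => ‖q - p‖)]
  · simp
  · intro t ht
    rw [Set.uIcc_of_le zero_le_one] at ht
    simp [h t ht]

lemma Joined.trans (hβ : 1 ≤ β) {p q r : Plane} {L L' : ℝ} (h : Joined ρ β p q L)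
    (h' : Joined ρ β q r L') : Joined ρ β p r (L + L') := by
  obtain ⟨γ, ⟨K, hK⟩, h0, h1, rfl⟩ := h
  obtain ⟨η, ⟨K', hK'⟩, h0', h1', rfl⟩ := h'
  -- Clamping freezes one curve at the junction `q` while the other moves, so subtracting `q`
  -- concatenates them and the Lipschitz property needs no gluing.
  set ζ : ℝ → Plane := fun t => γ (min (2 * t) 1) + η (max (2 * t - 1) 0) - q with hζ
  have hleft : ∀ t < 1 / 2, ζ t = γ (2 * t) := fun t ht => by
    simp only [hζ]
    rw [min_eq_left (by linarith), max_eq_right (by linarith), h0', add_sub_cancel_right]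
  have hright : ∀ t, 1 / 2 < t → ζ t = η (2 * t - 1) := fun t ht => by
    simp only [hζ]
    rw [min_eq_right (by linarith), max_eq_left (by linarith), h1, add_sub_cancel_left]
  have hmul : LipschitzWith 2 (fun t : ℝ => 2 * t) := by
    refine LipschitzWith.of_dist_le_mul fun x y => ?_
    rw [Real.dist_eq, ← mul_sub, abs_mul, abs_two]
    rfl
  have hLip : ∃ K, LipschitzWith K ζ := by
    have hsub : LipschitzWith 2 (fun t : ℝ => 2 * t - 1) := by
      simpa using hmul.sub (LipschitzWith.const (1 : ℝ))
    exact ⟨_, ((hK.comp (hmul.min_const 1)).add (hK'.comp (hsub.max_const 0))).sub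
      (LipschitzWith.const q)⟩
  obtain ⟨C, hC⟩ := hLip
  refine ⟨ζ, ⟨C, hC⟩, ?_, ?_, ?_⟩
  · rw [hleft 0 (by norm_num), mul_zero, h0]
  · rw [hright 1 (by norm_num)]
    norm_num [h1']
  have hint : ∀ a b, IntervalIntegrable (speed ρ β ζ) volume a b := fun a b =>
    intervalIntegrable_speed hC.lipschitzOnWith.absolutelyContinuousOnInterval ρ hβ
  have e1 : ∫ t in (0 : ℝ)..1 / 2, speed ρ β ζ t = curveLength ρ β γ := by
    have : ∀ t ∈ Set.Ioo (0 : ℝ) (1 / 2), speed ρ β ζ t = 2 * speed ρ β γ (2 * t) := by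
      intro t ht
      have hev : ζ =ᶠ[𝓝 t] fun s => γ (2 * s) := by
        filter_upwards [Iio_mem_nhds ht.2] with s hs using hleft s hs
      rw [speed, speed, hev.deriv_eq, hleft t ht.2, deriv_comp_mul_left, norm_smul,
        Real.norm_of_nonneg zero_le_two]
      ring
    rw [intervalIntegral.integral_congr_Ioo_of_le (by norm_num) this,
      intervalIntegral.integral_const_mul, intervalIntegral.mul_integral_comp_mul_left]
    norm_num
    rfl
  have e2 : ∫ t in (1 / 2 : ℝ)..1, speed ρ β ζ t = curveLength ρ β η := by
    have : ∀ t ∈ Set.Ioo (1 / 2 : ℝ) 1, speed ρ β ζ t = 2 * speed ρ β η (2 * t - 1) := by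
      intro t ht
      have hev : ζ =ᶠ[𝓝 t] fun s => η (2 * s - 1) := by
        filter_upwards [Ioi_mem_nhds ht.1] with s hs using hright s hs
      rw [speed, speed, hev.deriv_eq, hright t ht.1,
        deriv_comp_mul_left 2 (fun s => η (s - 1)), deriv_comp_sub_const, norm_smul,
        Real.norm_of_nonneg zero_le_two]
      ring
    rw [intervalIntegral.integral_congr_Ioo_of_le (by norm_num) this,
      intervalIntegral.integral_const_mul, intervalIntegral.mul_integral_comp_mul_sub]
    norm_num
    rfl
  rw [← e1, ← e2, intervalIntegral.integral_add_adjacent_intervals (hint _ _) (hint _ _)]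
  rfl

lemma norm_eq_slant (a b : ℝ) : ‖(!₂[a, b] : Plane)‖ = slant b a := by
  rw [EuclideanSpace.norm_eq, Fin.sum_univ_two, slant]
  simp [add_comm]

/-- The oblique crossing of a horizontal strip followed by that of a vertical strip. -/
lemma joined_lattice_step (hρ : ρ ∈ Set.Ioo (1 / 2 : ℝ) 1) (hβ : 1 ≤ β) (i j m : ℤ) :
    Joined ρ β !₂[(i : ℝ), (j : ℝ)] !₂[(i + m : ℝ), (j + 1 : ℝ)] (ell ρ m + ell ρ 1) := by
  have hd : 0 < 1 - ρ := by linarith [hρ.2]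
  have hd1 : 0 < ρ := by linarith [hρ.1]
  have h1 : Joined ρ β !₂[(i : ℝ), (j : ℝ)] !₂[(i + m - (1 - ρ) : ℝ), (j + (1 - ρ) : ℝ)]
      (ell ρ m) := by
    have := Joined.segment (ρ := ρ) (β := β) (p := !₂[(i : ℝ), (j : ℝ)])
      (q := !₂[(i + m - (1 - ρ) : ℝ), (j + (1 - ρ) : ℝ)]) fun t ht => by
        refine shiftedCoeff_of_fract_snd hρ ?_
        have hfl : ⌊(j : ℝ) + t * (1 - ρ)⌋ = j :=
          Int.floor_eq_iff.2 ⟨by nlinarith [ht.1], by nlinarith [ht.2]⟩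
        simp only [PiLp.add_apply, PiLp.smul_apply, PiLp.sub_apply, Matrix.cons_val_one,
          Matrix.cons_val_fin_one, smul_eq_mul, add_sub_cancel_left]
        rw [← Int.self_sub_floor, hfl]
        nlinarith [ht.2]
    convert this using 1
    rw [ell_eq_slant, ← norm_eq_slant]
    congr 1
    ext l
    fin_cases l <;> simp
    ring
  have h2 : Joined ρ β !₂[(i + m - (1 - ρ) : ℝ), (j + (1 - ρ) : ℝ)]
      !₂[(i + m : ℝ), (j + 1 : ℝ)] (ell ρ 1) := by
    have := Joined.segment (ρ := ρ) (β := β)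
      (p := !₂[(i + m - (1 - ρ) : ℝ), (j + (1 - ρ) : ℝ)])
      (q := !₂[(i + m : ℝ), (j + 1 : ℝ)]) fun t ht => by
        refine shiftedCoeff_of_fract_fst hρ ?_
        simp only [PiLp.add_apply, PiLp.smul_apply, PiLp.sub_apply, Matrix.cons_val_zero,
          smul_eq_mul, sub_sub_cancel]
        -- At `t = 1` the abscissa is an integer and its floor jumps; fractional part zero is still
        -- outside the open column.
        obtain h | h := ht.2.eq_or_lt
        · have : (i + m - (1 - ρ) + t * (1 - ρ) : ℝ) = ((i + m : ℤ) : ℝ) := by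
            rw [h]; push_cast; ring
          rw [this, Int.fract_intCast]
          simp
        · have hfl : ⌊(i + m - (1 - ρ) + t * (1 - ρ) : ℝ)⌋ = i + m - 1 :=
            Int.floor_eq_iff.2 ⟨by push_cast; nlinarith [ht.1], by push_cast; nlinarith⟩
          rw [← Int.self_sub_floor, hfl]
          push_cast
          rintro ⟨_, h3⟩
          nlinarith [ht.1]
    convert this using 1
    have e : (!₂[(i + m : ℝ), (j + 1 : ℝ)] - !₂[(i + m - (1 - ρ) : ℝ), (j + (1 - ρ) : ℝ)] : Plane)
        = !₂[1 - ρ, ρ] := by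
      ext l
      fin_cases l <;> simp
    rw [e, norm_eq_slant, ell_eq_slant, slant, slant]
    congr 1
    ring
  exact h1.trans hβ h2

lemma joined_lattice_steps (hρ : ρ ∈ Set.Ioo (1 / 2 : ℝ) 1) (hβ : 1 ≤ β) (i j m : ℤ) (n : ℕ) :
    Joined ρ β !₂[(i : ℝ), (j : ℝ)] !₂[(i + n * m : ℝ), (j + n : ℝ)]
      (n * (ell ρ m + ell ρ 1)) := by
  induction n with
  | zero => simpa using Joined.refl (ρ := ρ) (β := β) !₂[(i : ℝ), (j : ℝ)]
  | succ n ih =>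
    have := ih.trans hβ (by
      simpa using joined_lattice_step (ρ := ρ) (β := β) hρ hβ (i + n * m) (j + n) m)
    convert this using 1
    · push_cast
      congr 2 <;> ring_nf
    · push_cast
      ring

end

end TwoPhase

end

/-! ### Matching the two bounds -/

theorem proposition1 (ρ β : ℝ) (hρ : ρ ∈ Set.Ioo (1 / 2 : ℝ) 1) (hβ : 2 < β)
    (M N : ℕ) (hN : 1 ≤ N) (hMN : N < M) :
    (∃ γ : ℝ → TwoPhase.Plane, TwoPhase.IsGeodesic ρ β !₂[0, 0] !₂[(M : ℝ), (N : ℝ)] γ) ∧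
    ∀ γ : ℝ → TwoPhase.Plane, TwoPhase.IsGeodesic ρ β !₂[0, 0] !₂[(M : ℝ), (N : ℝ)] γ →
      TwoPhase.curveLength ρ β γ =
        (N : ℝ) * TwoPhase.ell ρ 1
        + ((M : ℝ) - (⌊(M : ℝ) / (N : ℝ)⌋ : ℝ) * (N : ℝ))
            * TwoPhase.ell ρ ((⌊(M : ℝ) / (N : ℝ)⌋ : ℝ) + 1)
        + ((N : ℝ) - (M : ℝ) + (⌊(M : ℝ) / (N : ℝ)⌋ : ℝ) * (N : ℝ))
            * TwoPhase.ell ρ (⌊(M : ℝ) / (N : ℝ)⌋ : ℝ) := by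
  have hN0 : (0 : ℝ) < N := by exact_mod_cast hN
  have hMN' : (N : ℝ) < M := by exact_mod_cast hMN
  set k := ⌊(M : ℝ) / N⌋ with hkdef
  have hk : 1 ≤ k := Int.le_floor.2 (by rw [Int.cast_one, le_div_iff₀ hN0]; linarith)
  have hk1 : (k : ℝ) * N ≤ M := (le_div_iff₀ hN0).1 (Int.floor_le _)
  have hk2 : (M : ℝ) < (k + 1) * N := (div_lt_iff₀ hN0).1 (Int.lt_floor_add_one _)
  -- `r` is the remainder of `M` modulo `N`: `r` rows advance by `k + 1` and the other `s = N - r`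
  -- by `k`.
  obtain ⟨r, hr⟩ : ∃ r : ℕ, (M : ℤ) - k * N = r := Int.eq_ofNat_of_zero_le (by
    have : k * (N : ℤ) ≤ M := by exact_mod_cast hk1
    linarith)
  have hr' : (M : ℝ) - k * N = r := by exact_mod_cast hr
  obtain ⟨s, hs⟩ : ∃ s : ℕ, N = r + s := Nat.exists_eq_add_of_le (by
    have : (r : ℝ) ≤ N := by linarith
    exact_mod_cast this)
  have hs' : (N : ℝ) = r + s := by exact_mod_cast hs
  have hβ1 : 1 ≤ β := by linarith
  obtain ⟨γ, ⟨K, hK⟩, h0, h1, hL⟩ : TwoPhase.Joined ρ β !₂[0, 0] !₂[(M : ℝ), (N : ℝ)]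
      (r * (TwoPhase.ell ρ (k + 1) + TwoPhase.ell ρ 1)
        + s * (TwoPhase.ell ρ k + TwoPhase.ell ρ 1)) := by
    have e1 := TwoPhase.joined_lattice_steps hρ hβ1 0 0 (k + 1) r
    have e2 := TwoPhase.joined_lattice_steps hρ hβ1 (r * (k + 1)) r k s
    push_cast at e1 e2
    simp only [zero_add] at e1
    have hM : (M : ℝ) = r * (k + 1) + s * k := by
      rw [hs'] at hr'
      linear_combination hr'
    rw [hM, hs']
    exact e1.trans hβ1 e2
  have hlow : ∀ η ∈ TwoPhase.admissible !₂[0, 0] !₂[(M : ℝ), (N : ℝ)],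
      TwoPhase.curveLength ρ β γ ≤ TwoPhase.curveLength ρ β η := by
    intro η hη
    have := TwoPhase.length_lower_bound hρ hβ hk (M := M) (by simpa using hη)
    refine le_trans (le_of_eq ?_) this
    -- Substituting `M = k * N + r` makes the secant contribute `ell ρ k` for each of the `N` rows
    -- plus `r` increments, which is the length of the path.
    rw [hL, TwoPhase.intercept, TwoPhase.rise, Int.cast_natCast,
      show (M : ℝ) = k * N + r by linarith, hs']
    ring
  have hγ : γ ∈ TwoPhase.admissible !₂[0, 0] !₂[(M : ℝ), (N : ℝ)] :=
    ⟨hK.lipschitzOnWith.absolutelyContinuousOnInterval, h0, h1⟩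
  refine ⟨⟨γ, hγ, hlow⟩, fun η hη => ?_⟩
  rw [le_antisymm (hη.2 γ hγ) (hlow η hη.1), hL,
    show (M : ℝ) = k * N + r by linarith, hs']
  ring
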